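/- Let $n\ge 1$, $\sigma>0$, and let $Y=g^0+\epsilon$, where $g^0\in\mathbb{R}^n$ is fixed and $\epsilon_1,\dots,\epsilon_n$ are i.i.d. $\mathcal N(0,\sigma^2)$. For $v\in\mathbb{R}^n$ write $\|v\|_n^2=\|v\|_2^2/n$. Let $\mathrm{pen}:\mathbb{R}^n\to\mathbb{R}\cup\{+\infty\}$ be convex and not identically $+\infty$, and let $\hat g$ be a regularized least-squares estimator, that is, almost surely $$\hat g\in\arg\min_{g\in\mathbb{R}^n}\bigl\{\|Y-g\|_n^2+\mathrm{pen}(g)\bigr\}$$ (it is assumed that this minimizer exists). Then $m_0:=\mathbb{E}\|\hat g-g^0\|_n$ is finite and $$\mathbb{P}\Bigl(\bigl|\,\|\hat g-g^0\|_n-m_0\bigr|\ge\sigma\sqrt{2t/n}\Bigr)\le e^{-t}\qquad\text{for all }t>0.$$ In particular, the same conclusion holds for the constrained least-squares estimator $\hat g=\arg\min_{g\in\mathcal G}\|Y-g\|_n^2$ over any non-empty closed convex set $\mathcal G\subseteq\mathbb{R}^n$. -/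

import Mathlib

open MeasureTheory ProbabilityTheory

noncomputable section

/-- The normalized Euclidean norm `‖v‖_n`, given by `‖v‖_n ^ 2 = ‖v‖₂ ^ 2 / n`. -/
def normN {n : ℕ} (v : EuclideanSpace ℝ (Fin n)) : ℝ :=
  Real.sqrt (‖v‖ ^ 2 / n)

/-- A penalty `pen : ℝⁿ → ℝ ∪ {+∞}` is convex if its epigraph is a convex set. -/
def ConvexPenalty {n : ℕ} (pen : EuclideanSpace ℝ (Fin n) → WithTop ℝ) : Prop :=
  Convex ℝ {p : EuclideanSpace ℝ (Fin n) × ℝ | pen p.1 ≤ (p.2 : WithTop ℝ)}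

/-- `g` minimizes the penalized least-squares objective `‖y - g‖_n ^ 2 + pen g` over `ℝⁿ`. -/
def IsRegularizedLSE {n : ℕ} (pen : EuclideanSpace ℝ (Fin n) → WithTop ℝ)
    (y g : EuclideanSpace ℝ (Fin n)) : Prop :=
  ∀ h : EuclideanSpace ℝ (Fin n),
    ((normN (y - g) ^ 2 : ℝ) : WithTop ℝ) + pen g ≤ ((normN (y - h) ^ 2 : ℝ) : WithTop ℝ) + pen h

/-- `g` minimizes the least-squares objective `‖y - g‖_n ^ 2` over the set `G`. -/
def IsConstrainedLSE {n : ℕ} (G : Set (EuclideanSpace ℝ (Fin n)))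
    (y g : EuclideanSpace ℝ (Fin n)) : Prop :=
  g ∈ G ∧ ∀ h ∈ G, normN (y - g) ^ 2 ≤ normN (y - h) ^ 2

/-- The coordinates of the noise vector `ε` are i.i.d. centred Gaussian with variance `σ ^ 2`. -/
structure IsGaussianNoise {Ω : Type*} [MeasurableSpace Ω] (P : Measure Ω) {n : ℕ} (σ : ℝ)
    (ε : Ω → EuclideanSpace ℝ (Fin n)) : Prop where
  law : ∀ i, HasLaw (fun ω => ε ω i) (gaussianReal 0 ⟨σ ^ 2, sq_nonneg σ⟩) P
  indep : iIndepFun (fun i ω => ε ω i) P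

/-- The error `‖ĝ - g⁰‖_n` has a finite mean `m₀`, and it deviates from `m₀` by at least
`σ √(2t/n)` with probability at most `exp (-t)`, for every `t > 0`. -/
def ErrorConcentrates {Ω : Type*} [MeasurableSpace Ω] (P : Measure Ω) {n : ℕ} (σ : ℝ)
    (g₀ : EuclideanSpace ℝ (Fin n)) (ghat : Ω → EuclideanSpace ℝ (Fin n)) : Prop :=
  Integrable (fun ω => normN (ghat ω - g₀)) P ∧
    ∀ t : ℝ, 0 < t →
      P.real {ω | σ * Real.sqrt (2 * t / n) ≤
        |normN (ghat ω - g₀) - ∫ ω', normN (ghat ω' - g₀) ∂P|} ≤ Real.exp (-t)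

end

/-!
Subtracting the first-order optimality conditions of two minimizers shows that least squares with a
convex penalty is a nonexpansive map of the data (`IsRegularizedLSE.norm_sub_le`). Hence, up to the
scaling factor `σ / √n`, the error `‖ĝ - g⁰‖_n` is a `1`-Lipschitz function `f` of a standard
Gaussian vector `X`, and the claim is the concentration inequality
`ℙ(|F| ≥ r) ≤ exp (-r² / 2)` for `F = f(X) - 𝔼 f(X)`, with `r = √(2t)`. A constrained estimator is
the special case of a penalty with values `0` and `⊤`.

The exponential-moment method yields this inequality only with a factor `2` in front, for the two
tails. The factor is removed by using more of the law of `F`, namely that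
`𝔼 F Ψ(F) ≤ 𝔼 Ψ'(F)` for all bounded nondecreasing `Ψ` (`covariance_comp_le_integral_deriv`;
this is the predicate `SteinDominated`). To see this for smooth `f`, let `Y` be an independent copy
of `X` and differentiate `θ ↦ 𝔼 Ψ(f(X)) f(X cos θ + Y sin θ)`: rotating the pair `(X, Y)` and
integrating by parts in `Y`, the derivative is at least `-sin θ * 𝔼 Ψ'(f(X))`; integrate over
`[0, π / 2]`. Mollification extends the inequality to Lipschitz `f`.

Two odd test functions then suffice.
* `Ψ(x) = sign x * (exp (min |x| r ^ 2 / 2) - 1)` gives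
  `exp (r² / 2) * 𝔼 |F| 1_{|F| ≥ r} ≤ 𝔼 |F|`, so `ℙ(|F| ≥ r) ≤ exp (-r² / 2) * 𝔼 |F| / r`, which
  is enough if `𝔼 |F| ≤ r` (`SteinDominated.mul_exp_mul_measureReal_le`).
* `Ψ(x) = sign x * min |x| r` gives `r * 𝔼 |F| ≤ (1 + r² / 4) * ℙ(|F| < r)`, so if `𝔼 |F| > r` then
  `ℙ(|F| < r) ≥ r² / (1 + r² / 4) ≥ 1 - exp (-r² / 2)` (`SteinDominated.mul_integral_abs_le`).
-/

open scoped RealInnerProductSpace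

/-! ### Gaussian integration by parts -/

section Gaussian

variable {E : Type*} [NormedAddCommGroup E] [InnerProductSpace ℝ E] [FiniteDimensional ℝ E]
  [MeasurableSpace E] [BorelSpace E]

/-- Stein's identity on the line. -/
lemma integral_mul_id_gaussianReal {h h' : ℝ → ℝ} {C D : ℝ} (hd : ∀ t, HasDerivAt h (h' t) t)
    (hc : Continuous h') (hC : ∀ t, |h t| ≤ C) (hD : ∀ t, |h' t| ≤ D) :
    ∫ t, h t * t ∂(gaussianReal 0 1) = ∫ t, h' t ∂(gaussianReal 0 1) := by
  have hpdf (t : ℝ) : HasDerivAt (gaussianPDFReal 0 1) (-(t * gaussianPDFReal 0 1 t)) t := by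
    have h1 : HasDerivAt (fun s : ℝ => -(s - 0) ^ 2 / (2 * (1 : NNReal))) (-t) t := by
      have := (((hasDerivAt_id t).sub_const 0).pow 2).neg.div_const (2 * ((1 : NNReal) : ℝ))
      refine this.congr_deriv ?_
      simp only [id, sub_zero, NNReal.coe_one]
      ring
    have h2 := (h1.exp).const_mul ((Real.sqrt (2 * Real.pi * (1 : NNReal)))⁻¹)
    rw [gaussianPDFReal_def]
    refine h2.congr_deriv ?_
    ring
  have hcont : Continuous h := continuous_iff_continuousAt.2 fun t => (hd t).continuousAt
  have hint : Integrable (fun t : ℝ => gaussianPDFReal 0 1 t) := integrable_gaussianPDFReal 0 1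
  have hint' : Integrable (fun t : ℝ => t * gaussianPDFReal 0 1 t) := by
    have := (integrable_mul_exp_neg_mul_sq (b := 1 / 2) (by norm_num)).const_mul
      ((Real.sqrt (2 * Real.pi * (1 : NNReal)))⁻¹)
    refine this.congr (.of_forall fun t => ?_)
    simp only [gaussianPDFReal, sub_zero]
    rw [show -(1 / 2) * t ^ 2 = -t ^ 2 / (2 * (1 : NNReal)) by push_cast; ring]
    ring
  have key := integral_mul_deriv_eq_deriv_mul_of_integrable (u := h) (u' := h')
    (v := gaussianPDFReal 0 1) (v' := fun t => -(t * gaussianPDFReal 0 1 t))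
    (fun t _ => hd t) (fun t _ => hpdf t)
    (hint'.neg.bdd_mul hcont.aestronglyMeasurable (.of_forall hC))
    (hint.bdd_mul hc.aestronglyMeasurable (.of_forall hD))
    (hint.bdd_mul hcont.aestronglyMeasurable (.of_forall hC))
  rw [integral_gaussianReal_eq_integral_smul one_ne_zero,
    integral_gaussianReal_eq_integral_smul one_ne_zero]
  have e1 : ∀ t : ℝ, gaussianPDFReal 0 1 t • (h t * t) =
      -(h t * -(t * gaussianPDFReal 0 1 t)) := fun t => by simp only [smul_eq_mul]; ring
  have e2 : ∀ t : ℝ, gaussianPDFReal 0 1 t • h' t = h' t * gaussianPDFReal 0 1 t :=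
    fun t => by simp only [smul_eq_mul]; ring
  simp only [e1, e2, integral_neg, key, neg_neg]

/-- Replacing the component of a standard Gaussian vector along a unit vector by an independent
standard Gaussian variable does not change its law. -/
lemma map_resample_stdGaussian {a : E} (ha : ‖a‖ = 1) :
    ((stdGaussian E).prod (gaussianReal 0 1)).map
      (fun p : E × ℝ => p.1 - ⟪a, p.1⟫ • a + p.2 • a) = stdGaussian E := by
  have hm : Continuous (fun p : E × ℝ => p.1 - ⟪a, p.1⟫ • a + p.2 • a) := by fun_prop
  have := Measure.isProbabilityMeasure_map (μ := (stdGaussian E).prod (gaussianReal 0 1))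
    hm.measurable.aemeasurable
  refine Measure.ext_of_charFun (funext fun s => ?_)
  rw [charFun_apply, integral_map hm.measurable.aemeasurable (by fun_prop)]
  have hpt (p : E × ℝ) : Complex.exp (⟪p.1 - ⟪a, p.1⟫ • a + p.2 • a, s⟫ * Complex.I) =
      Complex.exp (⟪p.1, s - ⟪a, s⟫ • a⟫ * Complex.I) *
        Complex.exp (⟪p.2, ⟪a, s⟫⟫ * Complex.I) := by
    rw [← Complex.exp_add, ← add_mul, ← Complex.ofReal_add]
    congr 3
    simp only [inner_add_left, inner_sub_left, inner_sub_right, real_inner_smul_left,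
      real_inner_smul_right, real_inner_comm a p.1]
    simp
    ring
  simp only [hpt]
  rw [integral_prod_mul (fun x : E => Complex.exp (⟪x, s - ⟪a, s⟫ • a⟫ * Complex.I))
    (fun t : ℝ => Complex.exp (⟪t, ⟪a, s⟫⟫ * Complex.I)), ← charFun_apply, ← charFun_apply,
    charFun_stdGaussian, charFun_gaussianReal, charFun_stdGaussian, ← Complex.exp_add]
  have hn : ‖s - ⟪a, s⟫ • a‖ ^ 2 = ‖s‖ ^ 2 - ⟪a, s⟫ ^ 2 := by
    rw [norm_sub_sq_real, real_inner_smul_right, norm_smul, ha, real_inner_comm a s]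
    simp
    ring
  congr 1
  rw [← Complex.ofReal_pow, ← Complex.ofReal_pow, hn]
  push_cast
  ring

lemma integral_mul_inner_stdGaussian_of_norm_eq_one {h : E → ℝ} {C D : ℝ} (hh : ContDiff ℝ 1 h)
    (hC : ∀ y, |h y| ≤ C) (hD : ∀ y, ‖fderiv ℝ h y‖ ≤ D) {a : E} (ha : ‖a‖ = 1) :
    ∫ y, h y * ⟪a, y⟫ ∂(stdGaussian E) = ∫ y, fderiv ℝ h y a ∂(stdGaussian E) := by
  have hT : Continuous (fun p : E × ℝ => p.1 - ⟪a, p.1⟫ • a + p.2 • a) := by fun_prop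
  have hfc : Continuous (fun y => fderiv ℝ h y a) :=
    (hh.continuous_fderiv one_ne_zero).clm_apply continuous_const
  have hD' (y : E) : |fderiv ℝ h y a| ≤ D := by
    have := (fderiv ℝ h y).le_opNorm a
    rw [ha, mul_one] at this
    exact this.trans (hD y)
  have hin (p : E × ℝ) : ⟪a, p.1 - ⟪a, p.1⟫ • a + p.2 • a⟫ = p.2 := by
    rw [inner_add_right, inner_sub_right, real_inner_smul_right, real_inner_smul_right,
      real_inner_self_eq_norm_sq, ha]
    ring
  have hint2 : Integrable (fun p : E × ℝ => p.2) ((stdGaussian E).prod (gaussianReal 0 1)) :=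
    Integrable.comp_snd (f := fun t : ℝ => t) IsGaussian.integrable_id _
  have hi1 : Integrable (fun p : E × ℝ => h (p.1 - ⟪a, p.1⟫ • a + p.2 • a) * p.2)
      ((stdGaussian E).prod (gaussianReal 0 1)) :=
    hint2.bdd_mul (hh.continuous.comp hT).aestronglyMeasurable (.of_forall fun p => hC _)
  have hi2 : Integrable (fun p : E × ℝ => fderiv ℝ h (p.1 - ⟪a, p.1⟫ • a + p.2 • a) a)
      ((stdGaussian E).prod (gaussianReal 0 1)) :=
    .of_bound (hfc.comp hT).aestronglyMeasurable D (.of_forall fun p => hD' _)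
  have hcont2 : Continuous (fun y : E => h y * ⟪a, y⟫) := hh.continuous.mul (by fun_prop)
  conv_lhs => rw [← map_resample_stdGaussian ha]
  conv_rhs => rw [← map_resample_stdGaussian ha]
  rw [integral_map hT.measurable.aemeasurable hcont2.aestronglyMeasurable,
    integral_map hT.measurable.aemeasurable hfc.aestronglyMeasurable]
  simp only [hin]
  rw [integral_prod _ hi1, integral_prod _ hi2]
  refine integral_congr_ae (.of_forall fun y => ?_)
  refine integral_mul_id_gaussianReal (h := fun t => h (y - ⟪a, y⟫ • a + t • a))
    (h' := fun t => fderiv ℝ h (y - ⟪a, y⟫ • a + t • a) a) (C := C) (D := D) (fun t => ?_)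
    (hfc.comp (by fun_prop)) (fun t => hC _) (fun t => hD' _)
  have hl : HasDerivAt (fun t : ℝ => y - ⟪a, y⟫ • a + t • a) a t := by
    simpa using ((hasDerivAt_id t).smul_const a).const_add (y - ⟪a, y⟫ • a)
  exact ((hh.differentiable one_ne_zero _).hasFDerivAt).comp_hasDerivAt t hl

/-- Gaussian integration by parts (Stein's identity). -/
lemma integral_mul_inner_stdGaussian {h : E → ℝ} {C D : ℝ} (hh : ContDiff ℝ 1 h)
    (hC : ∀ y, |h y| ≤ C) (hD : ∀ y, ‖fderiv ℝ h y‖ ≤ D) (a : E) :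
    ∫ y, h y * ⟪a, y⟫ ∂(stdGaussian E) = ∫ y, fderiv ℝ h y a ∂(stdGaussian E) := by
  by_cases ha : a = 0
  · simp [ha]
  have hu := integral_mul_inner_stdGaussian_of_norm_eq_one hh hC hD (a := ‖a‖⁻¹ • a)
    (norm_smul_inv_norm (𝕜 := ℝ) ha)
  have e1 : ∀ y : E, h y * ⟪‖a‖⁻¹ • a, y⟫ = ‖a‖⁻¹ * (h y * ⟪a, y⟫) := fun y => by
    rw [real_inner_smul_left]; ring
  simp only [e1, map_smul, smul_eq_mul, integral_const_mul] at hu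
  exact mul_left_cancel₀ (inv_ne_zero (norm_ne_zero_iff.2 ha)) hu

/-! ### The Gaussian covariance inequality -/

lemma LipschitzWith.integrable_stdGaussian {f : E → ℝ} {K : NNReal} (hf : LipschitzWith K f) :
    Integrable f (stdGaussian E) := by
  have hid : Integrable (fun x : E => ‖x‖) (stdGaussian E) := IsGaussian.integrable_id.norm
  refine ((hid.const_mul K).add (integrable_const |f 0|)).mono'
    hf.continuous.aestronglyMeasurable (.of_forall fun x => ?_)
  have := hf.dist_le_mul x 0
  rw [dist_zero_right, Real.dist_eq] at this
  rw [Real.norm_eq_abs]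
  simp only [Pi.add_apply]
  linarith [abs_sub_abs_le_abs_sub (f x) (f 0)]

lemma integral_comp_cos_smul_sub_sin_smul (θ : ℝ) {φ : E → ℝ} (hφ : Continuous φ) :
    ∫ p : E × E, φ (Real.cos θ • p.1 - Real.sin θ • p.2) ∂((stdGaussian E).prod (stdGaussian E)) =
      ∫ x, φ x ∂(stdGaussian E) := by
  have hr := IsGaussian.map_rotation_eq_self (μ := stdGaussian E) integral_id_stdGaussian (-θ)
  have hc : Continuous (fun p : E × E => φ p.1) := by fun_prop
  have h1 : ∫ p : E × E, φ p.1 ∂((stdGaussian E).prod (stdGaussian E)) =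
      ∫ x, φ x ∂(stdGaussian E) := by
    simpa using integral_fun_fst (μ := stdGaussian E) (ν := stdGaussian E) φ
  rw [← h1]
  conv_rhs => rw [← hr]
  rw [integral_map (by fun_prop) hc.aestronglyMeasurable]
  simp [ContinuousLinearMap.rotation_apply, sub_eq_add_neg]

/-- The derivative of `θ ↦ 𝔼 Ψ(f(X)) f(X cos θ + Y sin θ)`, for independent standard Gaussian
vectors `X`, `Y`, is computed by rotating the pair `(X, Y)` and then integrating by parts in the
second variable. -/
lemma neg_sin_mul_le_integral_rotation {f : E → ℝ} (hf : ContDiff ℝ 1 f)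
    (hL : LipschitzWith 1 f) {Ψ ψ : ℝ → ℝ} {B C : ℝ} (hΨ : ∀ x, HasDerivAt Ψ (ψ x) x)
    (hψc : Continuous ψ) (hψ0 : ∀ x, 0 ≤ ψ x) (hψB : ∀ x, ψ x ≤ B) (hΨC : ∀ x, |Ψ x| ≤ C)
    {θ : ℝ} (hθ : 0 ≤ Real.sin θ) :
    -(Real.sin θ * ∫ x, ψ (f x) ∂(stdGaussian E)) ≤
      ∫ p : E × E, Ψ (f p.1) * fderiv ℝ f (Real.cos θ • p.1 + Real.sin θ • p.2)
        (-Real.sin θ • p.1 + Real.cos θ • p.2) ∂((stdGaussian E).prod (stdGaussian E)) := by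
  set γ := stdGaussian E with hγ
  set c := Real.cos θ with hc
  set s := Real.sin θ with hs
  have hcs : c * c + s * s = 1 := by
    have := Real.cos_sq_add_sin_sq θ
    rw [hc, hs]; linarith
  have hΨcont : Continuous Ψ := continuous_iff_continuousAt.2 fun x => (hΨ x).continuousAt
  have hf' : Continuous (fderiv ℝ f) := hf.continuous_fderiv one_ne_zero
  have hf1 (x : E) : ‖fderiv ℝ f x‖ ≤ 1 := by
    simpa using norm_fderiv_le_of_lipschitz ℝ (x₀ := x) hL
  set G : E × E → ℝ := fun q => Ψ (f (c • q.1 - s • q.2)) * fderiv ℝ f q.1 q.2 with hG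
  have hGc : Continuous G := by
    have : Continuous (fun q : E × E => fderiv ℝ f q.1 q.2) :=
      (hf'.comp continuous_fst).clm_apply continuous_snd
    have h2 : Continuous (fun q : E × E => Ψ (f (c • q.1 - s • q.2))) :=
      hΨcont.comp (hf.continuous.comp (by fun_prop))
    exact h2.mul this
  have hrot : ∫ p : E × E, Ψ (f p.1) * fderiv ℝ f (c • p.1 + s • p.2)
      (-s • p.1 + c • p.2) ∂(γ.prod γ) = ∫ q, G q ∂(γ.prod γ) := by
    conv_rhs => rw [← IsGaussian.map_rotation_eq_self (μ := γ) integral_id_stdGaussian θ]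
    rw [integral_map (by fun_prop) hGc.aestronglyMeasurable]
    refine integral_congr_ae (.of_forall fun p => ?_)
    simp only [hG, ContinuousLinearMap.rotation_apply, ← hc, ← hs]
    have : c • (c • p.1 + s • p.2) - s • (-s • p.1 + c • p.2) = p.1 := by
      calc _ = (c * c + s * s) • p.1 := by module
        _ = p.1 := by rw [hcs, one_smul]
    rw [this]
  have hsnd : Integrable (fun q : E × E => ‖q.2‖) (γ.prod γ) :=
    Integrable.comp_snd (f := fun t : E => ‖t‖) IsGaussian.integrable_id.norm _
  have hGi : Integrable G (γ.prod γ) := by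
    refine (hsnd.const_mul C).mono' hGc.aestronglyMeasurable (.of_forall fun q => ?_)
    rw [hG, norm_mul]
    refine mul_le_mul (hΨC _) ?_ (norm_nonneg _) ((abs_nonneg _).trans (hΨC 0))
    simpa using (fderiv ℝ f q.1).le_of_opNorm_le (hf1 _) q.2
  have hψint : Integrable (fun q : E × E => ψ (f (c • q.1 - s • q.2))) (γ.prod γ) := by
    refine .of_bound (hψc.comp (hf.continuous.comp (by fun_prop))).aestronglyMeasurable B
      (.of_forall fun q => ?_)
    rw [Real.norm_eq_abs, abs_of_nonneg (hψ0 _)]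
    exact hψB _
  -- integration by parts in the second variable, the first one being fixed
  have hibp (x : E) : -s * ∫ y, ψ (f (c • x - s • y)) ∂γ ≤ ∫ y, G (x, y) ∂γ := by
    set a : E := (InnerProductSpace.toDual ℝ E).symm (fderiv ℝ f x) with ha
    have ha1 : ‖a‖ ≤ 1 := by rw [ha, LinearIsometryEquiv.norm_map]; exact hf1 x
    have hder (y : E) : HasFDerivAt (fun y => Ψ (f (c • x - s • y)))
        ((ψ (f (c • x - s • y)) * -s) • fderiv ℝ f (c • x - s • y)) y := by
      have h1 : HasFDerivAt (fun y : E => c • x - s • y) (-s • ContinuousLinearMap.id ℝ E) y := by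
        simpa using ((hasFDerivAt_id y).const_smul s).const_sub (c • x)
      have h2 := ((hf.differentiable one_ne_zero (c • x - s • y)).hasFDerivAt).comp y h1
      have h3 := (hΨ (f (c • x - s • y))).comp_hasFDerivAt y h2
      refine h3.congr_fderiv ?_
      ext v
      simp
      ring
    have hfd (y : E) := (hder y).fderiv
    have hcd : ContDiff ℝ 1 (fun y => Ψ (f (c • x - s • y))) := by
      have hΨ1 : ContDiff ℝ 1 Ψ := by
        refine contDiff_one_iff_deriv.2 ⟨fun x => (hΨ x).differentiableAt, ?_⟩
        rwa [show deriv Ψ = ψ from funext fun x => (hΨ x).deriv]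
      exact hΨ1.comp (hf.comp (by fun_prop))
    have hst := integral_mul_inner_stdGaussian hcd (C := C) (D := B * |s|) (fun y => hΨC _)
      (fun y => by
        rw [hfd, norm_smul, norm_mul, norm_neg, Real.norm_eq_abs, Real.norm_eq_abs,
          abs_of_nonneg (hψ0 _)]
        refine (mul_le_of_le_one_right (by have := hψ0 (f (c • x - s • y)); positivity)
          (hf1 _)).trans ?_
        exact mul_le_mul_of_nonneg_right (hψB _) (abs_nonneg _)) a
    have e1 : ∫ y, G (x, y) ∂γ = ∫ y, Ψ (f (c • x - s • y)) * ⟪a, y⟫ ∂γ := by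
      refine integral_congr_ae (.of_forall fun y => ?_)
      simp only [hG, ha, InnerProductSpace.toDual_symm_apply]
    rw [e1, hst, ← integral_const_mul]
    have hcx : Continuous (fun y : E => ψ (f (c • x - s • y))) :=
      hψc.comp (hf.continuous.comp (by fun_prop))
    have hix : Integrable (fun y : E => ψ (f (c • x - s • y))) γ := by
      refine .of_bound hcx.aestronglyMeasurable B (.of_forall fun q => ?_)
      rw [Real.norm_eq_abs, abs_of_nonneg (hψ0 _)]
      exact hψB _
    have hle (y : E) : |fderiv ℝ f (c • x - s • y) a| ≤ 1 := by
      have := (fderiv ℝ f (c • x - s • y)).le_of_opNorm_le (hf1 _) a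
      rw [one_mul] at this
      exact this.trans ha1
    refine integral_mono (hix.const_mul _) ?_ (fun y => ?_)
    · refine .of_bound (C := B * |s|) ?_ (.of_forall fun y => ?_)
      · exact ((hcd.continuous_fderiv one_ne_zero).clm_apply
          continuous_const).aestronglyMeasurable
      · rw [hfd, smul_apply, smul_eq_mul, norm_mul, norm_mul, norm_neg]
        simp only [Real.norm_eq_abs]
        rw [abs_of_nonneg (hψ0 _)]
        refine (mul_le_of_le_one_right (by have := hψ0 (f (c • x - s • y)); positivity)
          (hle _)).trans ?_
        exact mul_le_mul_of_nonneg_right (hψB _) (abs_nonneg _)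
    · simp only [hfd, smul_apply, smul_eq_mul]
      have h0 : 0 ≤ s * ψ (f (c • x - s • y)) := mul_nonneg hθ (hψ0 _)
      nlinarith [(abs_le.1 (hle y)).2]
  rw [hrot, integral_prod _ hGi, ← integral_comp_cos_smul_sub_sin_smul θ
    (φ := fun x => ψ (f x)) (hψc.comp hf.continuous), integral_prod _ hψint, ← neg_mul,
    ← integral_const_mul]
  exact integral_mono (hψint.integral_prod_left.const_mul _) hGi.integral_prod_left hibp

/-- **Gaussian covariance inequality** for a smooth `1`-Lipschitz function `f` and a nondecreasing
function `Ψ`: the covariance of `f` and `Ψ ∘ f` is at most the mean of `Ψ' ∘ f`. -/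
lemma covariance_comp_le_integral_deriv_of_contDiff {f : E → ℝ} (hf : ContDiff ℝ 1 f)
    (hL : LipschitzWith 1 f) {Ψ ψ : ℝ → ℝ} {B C : ℝ} (hΨ : ∀ x, HasDerivAt Ψ (ψ x) x)
    (hψc : Continuous ψ) (hψ0 : ∀ x, 0 ≤ ψ x) (hψB : ∀ x, ψ x ≤ B) (hΨC : ∀ x, |Ψ x| ≤ C) :
    ∫ x, Ψ (f x) * f x ∂(stdGaussian E) -
      (∫ x, Ψ (f x) ∂(stdGaussian E)) * ∫ x, f x ∂(stdGaussian E) ≤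
        ∫ x, ψ (f x) ∂(stdGaussian E) := by
  set γ := stdGaussian E with hγ
  have hΨcont : Continuous Ψ := continuous_iff_continuousAt.2 fun x => (hΨ x).continuousAt
  have hf' : Continuous (fderiv ℝ f) := hf.continuous_fderiv one_ne_zero
  have hf1 (x : E) : ‖fderiv ℝ f x‖ ≤ 1 := by
    simpa using norm_fderiv_le_of_lipschitz ℝ (x₀ := x) hL
  set K : ℝ → ℝ := fun θ =>
    ∫ p : E × E, Ψ (f p.1) * f (Real.cos θ • p.1 + Real.sin θ • p.2) ∂(γ.prod γ) with hK
  set K' : ℝ → ℝ := fun θ =>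
    ∫ p : E × E, Ψ (f p.1) * fderiv ℝ f (Real.cos θ • p.1 + Real.sin θ • p.2)
      (-Real.sin θ • p.1 + Real.cos θ • p.2) ∂(γ.prod γ) with hK'
  have hC0 : 0 ≤ C := (abs_nonneg _).trans (hΨC 0)
  have hn1 : Integrable (fun q : E × E => ‖q.1‖) (γ.prod γ) :=
    Integrable.comp_fst (f := fun t : E => ‖t‖) IsGaussian.integrable_id.norm _
  have hn2 : Integrable (fun q : E × E => ‖q.2‖) (γ.prod γ) :=
    Integrable.comp_snd (f := fun t : E => ‖t‖) IsGaussian.integrable_id.norm _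
  have hcs (u v : ℝ) (hu : |u| ≤ 1) (hv : |v| ≤ 1) (p : E × E) :
      ‖u • p.1 + v • p.2‖ ≤ ‖p.1‖ + ‖p.2‖ := by
    refine (norm_add_le _ _).trans (add_le_add ?_ ?_) <;> rw [norm_smul]
    · exact mul_le_of_le_one_left (norm_nonneg _) hu
    · exact mul_le_of_le_one_left (norm_nonneg _) hv
  have hKc (θ : ℝ) : Continuous
      (fun p : E × E => Ψ (f p.1) * f (Real.cos θ • p.1 + Real.sin θ • p.2)) :=
    (hΨcont.comp (hf.continuous.comp continuous_fst)).mul (hf.continuous.comp (by fun_prop))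
  have hKd (θ : ℝ) : HasDerivAt K (K' θ) θ := by
    refine (hasDerivAt_integral_of_dominated_loc_of_deriv_le (s := Set.univ)
      (F := fun θ (p : E × E) => Ψ (f p.1) * f (Real.cos θ • p.1 + Real.sin θ • p.2))
      (F' := fun θ (p : E × E) => Ψ (f p.1) * fderiv ℝ f (Real.cos θ • p.1 + Real.sin θ • p.2)
        (-Real.sin θ • p.1 + Real.cos θ • p.2))
      (bound := fun p => C * (‖p.1‖ + ‖p.2‖)) Filter.univ_mem
      (.of_forall fun t => (hKc t).aestronglyMeasurable) ?_ ?_ ?_ ?_ ?_).2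
    · refine (((hn1.add hn2).add (integrable_const |f 0|)).const_mul C).mono'
        (hKc θ).aestronglyMeasurable (.of_forall fun p => ?_)
      rw [norm_mul]
      refine mul_le_mul (hΨC _) ?_ (norm_nonneg _) hC0
      have h1 := hL.dist_le_mul (Real.cos θ • p.1 + Real.sin θ • p.2) 0
      rw [dist_zero_right, Real.dist_eq] at h1
      have h2 := hcs _ _ (Real.abs_cos_le_one θ) (Real.abs_sin_le_one θ) p
      have h3 := abs_sub_abs_le_abs_sub (f (Real.cos θ • p.1 + Real.sin θ • p.2)) (f 0)
      simp only [Pi.add_apply, Real.norm_eq_abs]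
      simp only [NNReal.coe_one, one_mul] at h1
      linarith
    · refine Continuous.aestronglyMeasurable ?_
      refine (hΨcont.comp (hf.continuous.comp continuous_fst)).mul ?_
      exact (hf'.comp (by fun_prop)).clm_apply (by fun_prop)
    · refine .of_forall fun p t _ => ?_
      rw [norm_mul]
      refine mul_le_mul (hΨC _) ?_ (norm_nonneg _) hC0
      refine ((fderiv ℝ f _).le_of_opNorm_le (hf1 _) _).trans ?_
      rw [one_mul]
      exact hcs _ _ (by rw [abs_neg]; exact Real.abs_sin_le_one t) (Real.abs_cos_le_one t) p
    · exact (hn1.add hn2).const_mul C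
    · refine .of_forall fun p t _ => ?_
      refine HasDerivAt.const_mul _ ?_
      have hl : HasDerivAt (fun t : ℝ => Real.cos t • p.1 + Real.sin t • p.2)
          (-Real.sin t • p.1 + Real.cos t • p.2) t :=
        ((Real.hasDerivAt_cos t).smul_const p.1).add ((Real.hasDerivAt_sin t).smul_const p.2)
      exact ((hf.differentiable one_ne_zero _).hasFDerivAt).comp_hasDerivAt t hl
  have hmono : MonotoneOn (fun θ => K θ - Real.cos θ * ∫ x, ψ (f x) ∂γ)
      (Set.Icc 0 (Real.pi / 2)) := by
    have hd (θ : ℝ) : HasDerivAt (fun θ => K θ - Real.cos θ * ∫ x, ψ (f x) ∂γ)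
        (K' θ - -Real.sin θ * ∫ x, ψ (f x) ∂γ) θ :=
      (hKd θ).sub ((Real.hasDerivAt_cos θ).mul_const _)
    refine monotoneOn_of_deriv_nonneg (convex_Icc _ _)
      (fun θ _ => (hd θ).continuousAt.continuousWithinAt)
      (fun θ _ => (hd θ).differentiableAt.differentiableWithinAt) (fun θ hθ => ?_)
    rw [interior_Icc] at hθ
    have hs : 0 ≤ Real.sin θ :=
      Real.sin_nonneg_of_nonneg_of_le_pi hθ.1.le (by linarith [hθ.2, Real.pi_pos])
    have := neg_sin_mul_le_integral_rotation hf hL hΨ hψc hψ0 hψB hΨC hs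
    rw [(hd θ).deriv]
    simp only [hK']
    linarith
  have hpi := Real.pi_pos
  have h := hmono (Set.left_mem_Icc.2 (by linarith)) (Set.right_mem_Icc.2 (by linarith))
    (by linarith)
  have h0 : K 0 = ∫ x, Ψ (f x) * f x ∂γ := by
    simp only [hK, Real.cos_zero, Real.sin_zero, one_smul, zero_smul, add_zero]
    simpa using integral_fun_fst (μ := γ) (ν := γ) (fun x => Ψ (f x) * f x)
  have h1 : K (Real.pi / 2) = (∫ x, Ψ (f x) ∂γ) * ∫ x, f x ∂γ := by
    simp only [hK, Real.cos_pi_div_two, Real.sin_pi_div_two, one_smul, zero_smul, zero_add]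
    exact integral_prod_mul (fun x => Ψ (f x)) f
  simp only [h0, h1, Real.cos_zero, Real.cos_pi_div_two] at h
  linarith

/-! ### Extension to Lipschitz functions by mollification -/

lemma LipschitzWith.exists_contDiff_lipschitzWith_near {f : E → ℝ} (hf : LipschitzWith 1 f)
    {δ : ℝ} (hδ : 0 < δ) :
    ∃ g : E → ℝ, ContDiff ℝ 1 g ∧ LipschitzWith 1 g ∧ ∀ x, |g x - f x| ≤ δ := by
  let φ : ContDiffBump (0 : E) := ⟨δ / 2, δ, by positivity, by linarith⟩
  have hi (x : E) : Integrable (fun t => φ.normed volume t * f (x - t)) :=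
    (φ.continuous_normed.mul (hf.continuous.comp (by fun_prop))).integrable_of_hasCompactSupport
      (φ.hasCompactSupport_normed.mul_right)
  refine ⟨convolution (φ.normed volume) f (ContinuousLinearMap.lsmul ℝ ℝ) volume, ?_, ?_, ?_⟩
  · exact_mod_cast HasCompactSupport.contDiff_convolution_left (n := 1) _
      φ.hasCompactSupport_normed φ.contDiff_normed hf.continuous.locallyIntegrable
  · refine LipschitzWith.of_dist_le_mul fun x y => ?_
    simp only [convolution_def, ContinuousLinearMap.lsmul_apply, smul_eq_mul, NNReal.coe_one,
      one_mul]
    rw [Real.dist_eq, ← integral_sub (hi x) (hi y), ← Real.norm_eq_abs]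
    have hle (t : E) : ‖φ.normed volume t * f (x - t) - φ.normed volume t * f (y - t)‖ ≤
        φ.normed volume t * dist x y := by
      rw [← mul_sub, norm_mul, Real.norm_of_nonneg (φ.nonneg_normed t)]
      refine mul_le_mul_of_nonneg_left ?_ (φ.nonneg_normed t)
      have := hf.dist_le_mul (x - t) (y - t)
      rwa [dist_sub_right, NNReal.coe_one, one_mul, Real.dist_eq] at this
    refine (norm_integral_le_of_norm_le (φ.integrable_normed.mul_const _)
      (.of_forall hle)).trans_eq ?_
    rw [integral_mul_const, φ.integral_normed, one_mul]
  · intro x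
    refine φ.dist_normed_convolution_le hf.continuous.aestronglyMeasurable fun y hy => ?_
    refine (hf.dist_le_mul y x).trans ?_
    rw [NNReal.coe_one, one_mul]
    exact (Metric.mem_ball.1 hy).le

lemma covariance_comp_le_integral_deriv {f : E → ℝ} (hf : LipschitzWith 1 f)
    {Ψ ψ : ℝ → ℝ} {B C : ℝ} (hΨ : ∀ x, HasDerivAt Ψ (ψ x) x)
    (hψc : Continuous ψ) (hψ0 : ∀ x, 0 ≤ ψ x) (hψB : ∀ x, ψ x ≤ B) (hΨC : ∀ x, |Ψ x| ≤ C) :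
    ∫ x, (f x - ∫ y, f y ∂(stdGaussian E)) * Ψ (f x - ∫ y, f y ∂(stdGaussian E))
        ∂(stdGaussian E) ≤
      ∫ x, ψ (f x - ∫ y, f y ∂(stdGaussian E)) ∂(stdGaussian E) := by
  set γ := stdGaussian E with hγ
  have hΨcont : Continuous Ψ := continuous_iff_continuousAt.2 fun x => (hΨ x).continuousAt
  have hC0 : 0 ≤ C := (abs_nonneg _).trans (hΨC 0)
  choose g hg hgL hgf using fun k : ℕ =>
    hf.exists_contDiff_lipschitzWith_near (δ := 1 / ((k : ℝ) + 1)) (by positivity)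
  have hsm (k : ℕ) : ∫ x, (g k x - ∫ y, g k y ∂γ) * Ψ (g k x - ∫ y, g k y ∂γ) ∂γ ≤
      ∫ x, ψ (g k x - ∫ y, g k y ∂γ) ∂γ := by
    have hi : Integrable (g k) γ := (hgL k).integrable_stdGaussian
    set m := ∫ y, g k y ∂γ with hm
    have hcm : Continuous fun x => Ψ (g k x - m) :=
      hΨcont.comp ((hg k).continuous.sub continuous_const)
    have hA := covariance_comp_le_integral_deriv_of_contDiff (hg k) (hgL k)
      (Ψ := fun x => Ψ (x - m)) (ψ := fun x => ψ (x - m)) (B := B) (C := C)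
      (fun x => (hΨ (x - m)).comp_sub_const x m)
      (hψc.comp (continuous_id.sub continuous_const)) (fun x => hψ0 _) (fun x => hψB _)
      (fun x => hΨC _)
    refine le_trans (le_of_eq ?_) hA
    have i1 : Integrable (fun x => Ψ (g k x - m) * g k x) γ :=
      hi.bdd_mul hcm.aestronglyMeasurable (.of_forall fun x => hΨC _)
    have i2 : Integrable (fun x => Ψ (g k x - m)) γ :=
      .of_bound hcm.aestronglyMeasurable C (.of_forall fun x => hΨC _)
    rw [← hm, ← integral_mul_const, ← integral_sub i1 (i2.mul_const _)]
    exact integral_congr_ae (.of_forall fun x => by ring)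
  have hiF : Integrable f γ := hf.integrable_stdGaussian
  have hmk (k : ℕ) : |∫ y, g k y ∂γ - ∫ y, f y ∂γ| ≤ 1 / ((k : ℝ) + 1) := by
    rw [← integral_sub (hgL k).integrable_stdGaussian hiF, ← Real.norm_eq_abs]
    refine (norm_integral_le_of_norm_le_const (.of_forall (hgf k))).trans_eq ?_
    simp
  have hFk (k : ℕ) (x : E) : |(g k x - ∫ y, g k y ∂γ) - (f x - ∫ y, f y ∂γ)| ≤
      2 * (1 / ((k : ℝ) + 1)) := by
    have h1 := abs_le.1 (hgf k x)
    have h2 := abs_le.1 (hmk k)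
    exact abs_le.2 ⟨by linarith [h1.1, h2.2], by linarith [h1.2, h2.1]⟩
  have hlim (x : E) : Filter.Tendsto (fun k => g k x - ∫ y, g k y ∂γ) Filter.atTop
      (nhds (f x - ∫ y, f y ∂γ)) := by
    rw [tendsto_iff_dist_tendsto_zero]
    refine squeeze_zero (fun _ => dist_nonneg) (fun k => hFk k x) ?_
    simpa using (tendsto_one_div_add_atTop_nhds_zero_nat (𝕜 := ℝ)).const_mul 2
  set m := ∫ y, f y ∂γ with hm
  have hcF (k : ℕ) : Continuous fun x => g k x - ∫ y, g k y ∂γ :=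
    (hg k).continuous.sub continuous_const
  refine le_of_tendsto_of_tendsto' (b := Filter.atTop)
    (f := fun k => ∫ x, (g k x - ∫ y, g k y ∂γ) * Ψ (g k x - ∫ y, g k y ∂γ) ∂γ)
    (g := fun k => ∫ x, ψ (g k x - ∫ y, g k y ∂γ) ∂γ) ?_ ?_ hsm
  · refine tendsto_integral_of_dominated_convergence (fun x => (|f x - m| + 2) * C)
      (fun k => ((hcF k).mul (hΨcont.comp (hcF k))).aestronglyMeasurable)
      ((((hiF.sub (integrable_const m)).abs).add (integrable_const 2)).mul_const C)
      (fun k => .of_forall fun x => ?_)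
      (.of_forall fun x => (hlim x).mul ((hΨcont.tendsto _).comp (hlim x)))
    rw [norm_mul]
    refine mul_le_mul ?_ (hΨC _) (norm_nonneg _) (by positivity)
    have h1 := hFk k x
    have h2 : 1 / ((k : ℝ) + 1) ≤ 1 := by
      rw [div_le_one (by positivity)]; linarith [(Nat.cast_nonneg k : (0 : ℝ) ≤ k)]
    have h3 := abs_sub_abs_le_abs_sub (g k x - ∫ y, g k y ∂γ) (f x - m)
    rw [Real.norm_eq_abs]
    linarith
  · refine tendsto_integral_of_dominated_convergence (fun _ => B)
      (fun k => (hψc.comp (hcF k)).aestronglyMeasurable) (integrable_const B)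
      (fun k => .of_forall fun x => ?_)
      (.of_forall fun x => (hψc.tendsto _).comp (hlim x))
    rw [Real.norm_of_nonneg (hψ0 _)]
    exact hψB _

end Gaussian

/-! ### Tail bounds from the covariance inequality -/

/-- The inequality `𝔼 F Ψ(F) ≤ 𝔼 Ψ'(F)` for all bounded nondecreasing test functions `Ψ` of class
`C¹` with bounded derivative `ψ`. For `F` with mean zero, the left-hand side is the covariance of
`F` and `Ψ(F)`. -/
def SteinDominated {Ω : Type*} [MeasurableSpace Ω] (μ : Measure Ω) (F : Ω → ℝ) : Prop :=
  ∀ (Ψ ψ : ℝ → ℝ) (B C : ℝ), (∀ x, HasDerivAt Ψ (ψ x) x) → Continuous ψ → (∀ x, 0 ≤ ψ x) →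
    (∀ x, ψ x ≤ B) → (∀ x, |Ψ x| ≤ C) → ∫ ω, F ω * Ψ (F ω) ∂μ ≤ ∫ ω, ψ (F ω) ∂μ

section SteinDominated

variable {Ω : Type*} [MeasurableSpace Ω] {μ : Measure Ω} [IsProbabilityMeasure μ] {F : Ω → ℝ}

/-- The test function is cut off continuously between the levels `r'` and `r`. -/
lemma SteinDominated.integral_abs_mul_le_of_lt (hS : SteinDominated μ F) (hF : Integrable F μ)
    {θ : ℝ → ℝ} (hθc : Continuous θ) (hθ0 : ∀ x, 0 ≤ θ x) (hθe : ∀ x, θ (-x) = θ x) {r' r : ℝ}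
    (hr' : 0 < r') (hr : r' < r) :
    ∫ ω, |F ω| * (∫ u in 0..min |F ω| r', θ u) ∂μ ≤ ∫ ω, {x | |x| < r}.indicator θ (F ω) ∂μ := by
  set ψ : ℝ → ℝ := fun x => θ x * max 0 (min 1 ((r - |x|) / (r - r'))) with hψ
  have hd : 0 < r - r' := by linarith
  have hψc : Continuous ψ := by
    have : Continuous fun x : ℝ => max 0 (min 1 ((r - |x|) / (r - r'))) := by fun_prop
    exact hθc.mul this
  have hψ0 (x : ℝ) : 0 ≤ ψ x := mul_nonneg (hθ0 x) (le_max_left _ _)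
  have hψe (x : ℝ) : ψ (-x) = ψ x := by simp only [hψ, hθe, abs_neg]
  have hψθ (x : ℝ) (hx : |x| ≤ r') : ψ x = θ x := by
    have : 1 ≤ (r - |x|) / (r - r') := by rw [le_div_iff₀ hd]; linarith
    simp [hψ, min_eq_left this]
  have hψz (x : ℝ) (hx : r ≤ |x|) : ψ x = 0 := by
    have : (r - |x|) / (r - r') ≤ 0 := div_nonpos_of_nonpos_of_nonneg (by linarith) hd.le
    simp only [hψ, max_eq_left ((min_le_right _ _).trans this), mul_zero]
  have hψle (x : ℝ) : ψ x ≤ {x | |x| < r}.indicator θ x := by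
    by_cases hx : |x| < r
    · rw [Set.indicator_of_mem (by exact hx)]
      exact mul_le_of_le_one_right (hθ0 x) (max_le zero_le_one (min_le_left _ _))
    · rw [Set.indicator_of_notMem (by exact hx), hψz x (not_lt.1 hx)]
  have hsupp : HasCompactSupport ψ := by
    refine HasCompactSupport.intro (isCompact_Icc (a := -r) (b := r)) fun x hx => hψz x ?_
    by_contra hlt
    exact hx (abs_le.1 (not_le.1 hlt).le)
  have hψi : Integrable ψ := hψc.integrable_of_hasCompactSupport hsupp
  obtain ⟨B, hB⟩ := hsupp.exists_bound_of_continuous hψc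
  set Ψ : ℝ → ℝ := fun x => ∫ u in 0..x, ψ u with hΨ
  have hΨd (x : ℝ) : HasDerivAt Ψ (ψ x) x := (hψc.integral_hasStrictDerivAt 0 x).hasDerivAt
  have hΨC (x : ℝ) : |Ψ x| ≤ ∫ u, ‖ψ u‖ :=
    (intervalIntegral.norm_integral_le_integral_norm_uIoc (f := ψ)).trans
      (setIntegral_le_integral hψi.norm (.of_forall fun u => norm_nonneg _))
  have hΨo (x : ℝ) : Ψ (-x) = -Ψ x := by
    have := intervalIntegral.integral_comp_neg (a := 0) (b := x) ψ
    simp only [hψe, neg_zero] at this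
    simp only [hΨ]
    rw [this, intervalIntegral.integral_symm]
  have hmain := hS Ψ ψ B (∫ u, ‖ψ u‖) hΨd hψc hψ0
    (fun x => (le_abs_self _).trans (hB x)) hΨC
  have hlow (x : ℝ) : |x| * ∫ u in 0..min |x| r', θ u ≤ x * Ψ x := by
    have e : x * Ψ x = |x| * Ψ |x| := by
      rcases abs_cases x with ⟨h, _⟩ | ⟨h, _⟩ <;> rw [h]
      rw [hΨo]; ring
    rw [e]
    refine mul_le_mul_of_nonneg_left ?_ (abs_nonneg x)
    have h0 : 0 ≤ min |x| r' := le_min (abs_nonneg x) hr'.le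
    have e2 : ∫ u in 0..min |x| r', θ u = ∫ u in 0..min |x| r', ψ u := by
      refine intervalIntegral.integral_congr fun u hu => (hψθ u ?_).symm
      rw [Set.uIcc_of_le h0] at hu
      rw [abs_of_nonneg hu.1]
      exact hu.2.trans (min_le_right _ _)
    rw [e2]
    exact intervalIntegral.integral_mono_interval le_rfl h0 (min_le_left _ _)
      (.of_forall hψ0) (hψc.intervalIntegrable _ _)
  have hΨcont : Continuous Ψ := continuous_iff_continuousAt.2 fun x => (hΨd x).continuousAt
  have hFm := hF.aestronglyMeasurable
  have hΘc : Continuous fun x : ℝ => ∫ u in 0..min |x| r', θ u :=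
    (intervalIntegral.continuous_primitive (fun a b => hθc.intervalIntegrable a b) 0).comp
      (by fun_prop)
  have i1 : Integrable (fun ω => F ω * Ψ (F ω)) μ :=
    hF.mul_bdd (hΨcont.comp_aestronglyMeasurable hFm) (.of_forall fun ω => hΨC _)
  have i0 : Integrable (fun ω => |F ω| * ∫ u in 0..min |F ω| r', θ u) μ := by
    refine i1.mono' (hFm.norm.mul (hΘc.comp_aestronglyMeasurable hFm)) (.of_forall fun ω => ?_)
    rw [Real.norm_of_nonneg]
    · exact hlow _
    · exact mul_nonneg (abs_nonneg _) (intervalIntegral.integral_nonneg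
        (le_min (abs_nonneg _) hr'.le) fun u _ => hθ0 u)
  have hms : MeasurableSet {x : ℝ | |x| < r} := measurableSet_lt measurable_norm measurable_const
  obtain ⟨D, hD⟩ := (isCompact_Icc (a := -r) (b := r)).exists_bound_of_continuousOn
    hθc.continuousOn
  have hD0 : 0 ≤ D := (norm_nonneg _).trans (hD 0 ⟨by linarith, by linarith⟩)
  have i2 : Integrable (fun ω => {x | |x| < r}.indicator θ (F ω)) μ := by
    refine .of_bound ((hθc.measurable.indicator hms).comp_aemeasurable
      hFm.aemeasurable).aestronglyMeasurable D (.of_forall fun ω => ?_)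
    by_cases hx : |F ω| < r
    · rw [Set.indicator_of_mem (by exact hx)]
      exact hD _ (abs_le.1 hx.le)
    · rw [Set.indicator_of_notMem (by exact hx), norm_zero]
      exact hD0
  have i3 : Integrable (fun ω => ψ (F ω)) μ :=
    .of_bound (hψc.comp_aestronglyMeasurable hFm) B (.of_forall fun ω => hB _)
  calc _ ≤ ∫ ω, F ω * Ψ (F ω) ∂μ := integral_mono i0 i1 fun ω => hlow _
    _ ≤ ∫ ω, ψ (F ω) ∂μ := hmain
    _ ≤ _ := integral_mono i3 i2 fun ω => hψle _

/-- The inequality defining `SteinDominated`, for the odd test function whose derivative is an even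
function `θ` truncated to `(-r, r)`. -/
lemma SteinDominated.integral_abs_mul_le (hS : SteinDominated μ F) (hF : Integrable F μ)
    {θ : ℝ → ℝ} (hθc : Continuous θ) (hθ0 : ∀ x, 0 ≤ θ x) (hθe : ∀ x, θ (-x) = θ x) {r : ℝ}
    (hr : 0 < r) :
    ∫ ω, |F ω| * (∫ u in 0..min |F ω| r, θ u) ∂μ ≤ ∫ ω, {x | |x| < r}.indicator θ (F ω) ∂μ := by
  have hFm := hF.aestronglyMeasurable
  have hΘc : Continuous fun x : ℝ => ∫ u in 0..x, θ u :=
    intervalIntegral.continuous_primitive (fun a b => hθc.intervalIntegrable a b) 0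
  refine le_of_tendsto (x := nhdsWithin r (Set.Iio r))
    (f := fun r' => ∫ ω, |F ω| * (∫ u in 0..min |F ω| r', θ u) ∂μ) ?_ ?_
  · refine tendsto_integral_filter_of_dominated_convergence
      (fun ω => |F ω| * ∫ u in 0..r, θ u) (.of_forall fun r' => ?_) ?_
      (hF.abs.mul_const _) (.of_forall fun ω => ?_)
    · exact hFm.norm.mul ((hΘc.comp (continuous_id.abs.min
        continuous_const)).comp_aestronglyMeasurable hFm)
    · filter_upwards [self_mem_nhdsWithin, nhdsWithin_le_nhds (lt_mem_nhds hr)] with r' h1 h2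
      refine .of_forall fun ω => ?_
      have h0 : 0 ≤ min |F ω| r' := le_min (abs_nonneg _) (le_of_lt h2)
      rw [norm_mul, Real.norm_of_nonneg (abs_nonneg _), Real.norm_of_nonneg
        (intervalIntegral.integral_nonneg h0 fun u _ => hθ0 u)]
      refine mul_le_mul_of_nonneg_left ?_ (abs_nonneg _)
      exact intervalIntegral.integral_mono_interval le_rfl h0
        ((min_le_right _ _).trans (le_of_lt h1)) (.of_forall hθ0) (hθc.intervalIntegrable _ _)
    · refine tendsto_nhdsWithin_of_tendsto_nhds ?_
      have hcr : Continuous fun r' : ℝ => |F ω| * ∫ u in 0..min |F ω| r', θ u :=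
        continuous_const.mul (hΘc.comp (continuous_const.min continuous_id))
      exact hcr.tendsto r
  · filter_upwards [self_mem_nhdsWithin, nhdsWithin_le_nhds (lt_mem_nhds hr)] with r' h1 h2
    exact hS.integral_abs_mul_le_of_lt hF hθc hθ0 hθe h2 h1

lemma integral_mul_exp_sq_div_two (y : ℝ) :
    ∫ u in 0..y, u * Real.exp (u ^ 2 / 2) = Real.exp (y ^ 2 / 2) - 1 := by
  have hd (x : ℝ) : HasDerivAt (fun u => Real.exp (u ^ 2 / 2)) (x * Real.exp (x ^ 2 / 2)) x := by
    have := (((hasDerivAt_id x).pow 2).div_const 2).exp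
    refine this.congr_deriv ?_
    simp
    ring
  rw [intervalIntegral.integral_eq_sub_of_hasDerivAt (fun x _ => hd x)
    ((by fun_prop : Continuous fun u : ℝ => u * Real.exp (u ^ 2 / 2)).intervalIntegrable _ _)]
  simp

/-- Test function `Ψ(x) = sign x * (exp (min |x| r ^ 2 / 2) - 1)`: the contributions of
`{|F| < r}` to the two sides differ by `𝔼 |F| 1_{|F| < r}` only. -/
lemma SteinDominated.mul_exp_mul_measureReal_le (hS : SteinDominated μ F) (hF : Integrable F μ)
    {r : ℝ} (hr : 0 < r) :
    r * Real.exp (r ^ 2 / 2) * μ.real {ω | r ≤ |F ω|} ≤ ∫ ω, |F ω| ∂μ := by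
  set θ : ℝ → ℝ := fun x => |x| * Real.exp (x ^ 2 / 2) with hθ
  have hθc : Continuous θ := by fun_prop
  have h := hS.integral_abs_mul_le hF (θ := θ) hθc (fun x => by positivity)
    (fun x => by simp [hθ]) hr
  have hΘ (ω : Ω) : ∫ u in 0..min |F ω| r, θ u = Real.exp ((min |F ω| r) ^ 2 / 2) - 1 := by
    have h0 : 0 ≤ min |F ω| r := le_min (abs_nonneg _) hr.le
    rw [← integral_mul_exp_sq_div_two]
    refine intervalIntegral.integral_congr fun u hu => ?_
    rw [Set.uIcc_of_le h0] at hu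
    simp only [hθ, abs_of_nonneg hu.1]
  simp only [hΘ] at h
  have hFm := hF.aestronglyMeasurable
  have hnull : NullMeasurableSet {ω | r ≤ |F ω|} μ :=
    nullMeasurableSet_le aemeasurable_const hFm.aemeasurable.abs
  have hms : MeasurableSet {x : ℝ | |x| < r} := measurableSet_lt measurable_norm measurable_const
  have i1 : Integrable (fun ω => |F ω| * (Real.exp ((min |F ω| r) ^ 2 / 2) - 1)) μ := by
    refine hF.abs.mul_bdd (c := Real.exp (r ^ 2 / 2)) ?_ (.of_forall fun ω => ?_)
    · exact (by fun_prop : Continuous fun x : ℝ =>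
        Real.exp ((min |x| r) ^ 2 / 2) - 1).comp_aestronglyMeasurable hFm
    · have h0 : 0 ≤ min |F ω| r := le_min (abs_nonneg _) hr.le
      have h1 : Real.exp ((min |F ω| r) ^ 2 / 2) ≤ Real.exp (r ^ 2 / 2) := by
        gcongr; exact min_le_right _ _
      have h2 : 1 ≤ Real.exp ((min |F ω| r) ^ 2 / 2) := Real.one_le_exp (by positivity)
      rw [Real.norm_of_nonneg (by linarith)]
      linarith
  have i2 : Integrable (fun ω => {x | |x| < r}.indicator θ (F ω)) μ := by
    refine .of_bound ((hθc.measurable.indicator hms).comp_aemeasurable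
      hFm.aemeasurable).aestronglyMeasurable (r * Real.exp (r ^ 2 / 2)) (.of_forall fun ω => ?_)
    by_cases hx : |F ω| < r
    · rw [Set.indicator_of_mem (by exact hx), Real.norm_of_nonneg (by positivity)]
      have hsq : (F ω) ^ 2 ≤ r ^ 2 := by rw [← sq_abs (F ω)]; gcongr
      simp only [hθ]
      gcongr
    · rw [Set.indicator_of_notMem (by exact hx), norm_zero]
      positivity
  have hpt (ω : Ω) : {ω | r ≤ |F ω|}.indicator (fun _ => r * Real.exp (r ^ 2 / 2)) ω ≤
      |F ω| * (Real.exp ((min |F ω| r) ^ 2 / 2) - 1) -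
        {x | |x| < r}.indicator θ (F ω) + |F ω| := by
    by_cases hx : |F ω| < r
    · rw [Set.indicator_of_notMem (by simpa using hx), Set.indicator_of_mem (by exact hx),
        min_eq_left hx.le, sq_abs]
      simp only [hθ]
      linarith
    · rw [Set.indicator_of_mem (by simpa using hx), Set.indicator_of_notMem (by exact hx),
        min_eq_right (not_lt.1 hx)]
      have := mul_le_mul_of_nonneg_right (not_lt.1 hx) (Real.exp_pos (r ^ 2 / 2)).le
      linarith
  have hmono := integral_mono (μ := μ) ((integrable_const _).indicator₀ hnull)
    ((i1.sub i2).add hF.abs) hpt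
  rw [integral_indicator₀ hnull, setIntegral_const, smul_eq_mul] at hmono
  have e := integral_add (i1.sub i2) hF.abs
  have e2 := integral_sub i1 i2
  simp only [Pi.sub_apply, Pi.add_apply] at e e2 hmono
  rw [e, e2] at hmono
  linarith

/-- Test function `Ψ(x) = sign x * min |x| r`. -/
lemma SteinDominated.mul_integral_abs_le (hS : SteinDominated μ F) (hF : Integrable F μ)
    {r : ℝ} (hr : 0 < r) :
    r * ∫ ω, |F ω| ∂μ ≤ (1 + r ^ 2 / 4) * μ.real {ω | |F ω| < r} := by
  have h := hS.integral_abs_mul_le hF (θ := fun _ => 1) continuous_const (fun _ => zero_le_one)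
    (fun _ => rfl) hr
  simp only [intervalIntegral.integral_const, sub_zero, smul_eq_mul, mul_one] at h
  have hFm := hF.aestronglyMeasurable
  have hnull : NullMeasurableSet {ω | |F ω| < r} μ :=
    nullMeasurableSet_lt hFm.aemeasurable.abs aemeasurable_const
  have e1 : ∫ ω, {x : ℝ | |x| < r}.indicator (fun _ => (1 : ℝ)) (F ω) ∂μ =
      μ.real {ω | |F ω| < r} := by
    have : ∀ ω, {x : ℝ | |x| < r}.indicator (fun _ => (1 : ℝ)) (F ω) =
        {ω | |F ω| < r}.indicator (fun _ => (1 : ℝ)) ω := fun ω => rfl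
    simp only [this]
    rw [integral_indicator₀ hnull, setIntegral_const, smul_eq_mul, mul_one]
  rw [e1] at h
  have hpt (ω : Ω) : r * |F ω| ≤
      |F ω| * min |F ω| r + {ω | |F ω| < r}.indicator (fun _ => r ^ 2 / 4) ω := by
    by_cases hx : |F ω| < r
    · rw [Set.indicator_of_mem (by exact hx), min_eq_left hx.le]
      nlinarith [sq_nonneg (|F ω| - r / 2)]
    · rw [Set.indicator_of_notMem (by exact hx), min_eq_right (not_lt.1 hx)]
      linarith
  have i1 : Integrable (fun ω => |F ω| * min |F ω| r) μ := by
    refine hF.abs.mul_bdd (c := r) ?_ (.of_forall fun ω => ?_)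
    · exact (by fun_prop : Continuous fun x : ℝ => min |x| r).comp_aestronglyMeasurable hFm
    · rw [Real.norm_of_nonneg (le_min (abs_nonneg _) hr.le)]
      exact min_le_right _ _
  have i2 : Integrable ({ω | |F ω| < r}.indicator fun _ => r ^ 2 / 4) μ :=
    (integrable_const _).indicator₀ hnull
  have hmono := integral_mono (μ := μ) (hF.abs.const_mul r) (i1.add i2) hpt
  have e := integral_add i1 i2
  simp only [Pi.add_apply] at e hmono
  rw [e, integral_indicator₀ hnull, setIntegral_const, smul_eq_mul, integral_const_mul] at hmono
  linarith

/-- If `𝔼 |F| ≤ r`, the exponential test function gives the bound. Otherwise the bound follows from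
a lower bound for the probability of `{|F| < r}`. -/
lemma SteinDominated.measureReal_le_exp (hS : SteinDominated μ F) (hF : Integrable F μ)
    {r : ℝ} (hr : 0 < r) : μ.real {ω | r ≤ |F ω|} ≤ Real.exp (-(r ^ 2 / 2)) := by
  rcases le_or_gt (∫ ω, |F ω| ∂μ) r with hM | hM
  · have h := (hS.mul_exp_mul_measureReal_le hF hr).trans hM
    have h1 : Real.exp (r ^ 2 / 2) * μ.real {ω | r ≤ |F ω|} ≤ 1 := by
      rw [mul_assoc] at h
      exact le_of_mul_le_mul_left (by linarith) hr
    rw [Real.exp_neg, ← one_div, le_div_iff₀ (Real.exp_pos _)]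
    linarith
  · have h := hS.mul_integral_abs_le hF hr
    have hnull : NullMeasurableSet {ω | |F ω| < r} μ :=
      nullMeasurableSet_lt hF.aestronglyMeasurable.aemeasurable.abs aemeasurable_const
    have hcompl : μ.real {ω | r ≤ |F ω|} = 1 - μ.real {ω | |F ω| < r} := by
      rw [← probReal_compl_eq_one_sub₀ hnull]
      congr 1
      ext ω
      simp
    set p := μ.real {ω | |F ω| < r} with hp
    have hrr : r * r ≤ (1 + r ^ 2 / 4) * p :=
      (mul_le_mul_of_nonneg_left hM.le hr.le).trans h
    rw [hcompl]
    have he := Real.add_one_le_exp (-(r ^ 2 / 2))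
    -- for `r ^ 2 ≤ 4` the factor `1 + r ^ 2 / 4` is at most `2`; beyond that `p ≥ 1`
    rcases le_or_gt (r ^ 2) 4 with h4 | h4
    · have : r ^ 2 / 2 ≤ p := by
        have hp0 : 0 ≤ p := measureReal_nonneg
        nlinarith
      linarith
    · have : 1 ≤ p := by
        by_contra hlt
        nlinarith
      linarith [Real.exp_pos (-(r ^ 2 / 2))]

end SteinDominated

/-! ### Gaussian concentration -/

section Concentration

variable {E : Type*} [NormedAddCommGroup E] [InnerProductSpace ℝ E] [FiniteDimensional ℝ E]
  [MeasurableSpace E] [BorelSpace E]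

lemma LipschitzWith.steinDominated {f : E → ℝ} (hf : LipschitzWith 1 f) :
    SteinDominated (stdGaussian E) (fun x => f x - ∫ y, f y ∂(stdGaussian E)) :=
  fun _ _ _ _ h1 h2 h3 h4 h5 => covariance_comp_le_integral_deriv hf h1 h2 h3 h4 h5

/-- Two-sided **Gaussian concentration** for Lipschitz functions, without a factor `2`. -/
lemma LipschitzWith.measureReal_le_exp_stdGaussian {f : E → ℝ}
    (hf : LipschitzWith 1 f) {r : ℝ} (hr : 0 < r) :
    (stdGaussian E).real {x | r ≤ |f x - ∫ y, f y ∂(stdGaussian E)|} ≤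
      Real.exp (-(r ^ 2 / 2)) :=
  hf.steinDominated.measureReal_le_exp (hf.integrable_stdGaussian.sub (integrable_const _)) hr

end Concentration

/-! ### Least-squares estimators -/

lemma normN_eq {n : ℕ} (v : EuclideanSpace ℝ (Fin n)) : normN v = ‖v‖ / Real.sqrt n := by
  rw [normN, Real.sqrt_div' _ (Nat.cast_nonneg n), Real.sqrt_sq (norm_nonneg v)]

lemma normN_sq {n : ℕ} (v : EuclideanSpace ℝ (Fin n)) : normN v ^ 2 = ‖v‖ ^ 2 / n :=
  Real.sq_sqrt (by positivity)

section

variable {n : ℕ} {pen : EuclideanSpace ℝ (Fin n) → WithTop ℝ}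
  {y y' g g' : EuclideanSpace ℝ (Fin n)}

lemma IsRegularizedLSE.ne_top (h : IsRegularizedLSE pen y g) (hpen : ∃ g, pen g ≠ ⊤) :
    pen g ≠ ⊤ := by
  obtain ⟨g₁, hg₁⟩ := hpen
  intro hg
  have := h g₁
  rw [hg, WithTop.add_top, top_le_iff, WithTop.add_eq_top] at this
  exact this.elim WithTop.coe_ne_top hg₁

/-- First-order optimality: comparison of `g` with the points of the segment `[g, g']`. -/
lemma IsRegularizedLSE.inner_le (hconv : ConvexPenalty pen)
    (h : IsRegularizedLSE pen y g) {a b : ℝ} (ha : pen g = a) (hb : pen g' = b) :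
    2 / n * ⟪y - g, g' - g⟫ ≤ b - a := by
  -- the quadratic remainder of the objective along the segment is `O(t)`
  have hseg (t : ℝ) (ht : 0 < t) (ht1 : t ≤ 1) :
      2 / n * ⟪y - g, g' - g⟫ ≤ b - a + t * (‖g' - g‖ ^ 2 / n) := by
    have hmem := hconv (x := (g, a)) (by simp [ha]) (y := (g', b)) (by simp [hb])
      (show 0 ≤ 1 - t by linarith) ht.le (by ring)
    simp only [Prod.smul_mk, Prod.mk_add_mk, Set.mem_ofPred_eq, smul_eq_mul] at hmem
    have hmin := (h ((1 - t) • g + t • g')).trans (add_le_add_right hmem _)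
    rw [ha, ← WithTop.coe_add, ← WithTop.coe_add, WithTop.coe_le_coe, normN_sq, normN_sq] at hmin
    have he : y - ((1 - t) • g + t • g') = (y - g) - t • (g' - g) := by module
    rw [he, norm_sub_sq_real (y - g), real_inner_smul_right, norm_smul, mul_pow, Real.norm_eq_abs,
      sq_abs, add_div, sub_div] at hmin
    refine le_of_mul_le_mul_left ?_ ht
    have e1 : t * (2 / n * ⟪y - g, g' - g⟫) = 2 * (t * ⟪y - g, g' - g⟫) / n := by ring
    have e2 : t * (t * (‖g' - g‖ ^ 2 / n)) = t ^ 2 * ‖g' - g‖ ^ 2 / n := by ring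
    rw [mul_add, e1, e2]
    linarith
  refine ge_of_tendsto (x := nhdsWithin (0 : ℝ) (Set.Ioi 0))
    (f := fun t => b - a + t * (‖g' - g‖ ^ 2 / n)) ?_ ?_
  · refine tendsto_nhdsWithin_of_tendsto_nhds ?_
    have hc : Continuous fun t : ℝ => b - a + t * (‖g' - g‖ ^ 2 / n) := by fun_prop
    simpa using hc.tendsto 0
  · filter_upwards [Ioc_mem_nhdsGT (zero_lt_one' ℝ)] with t ht
    exact hseg t ht.1 ht.2

/-- Penalized least squares with a convex penalty is a nonexpansive map of the data. -/
lemma IsRegularizedLSE.norm_sub_le (hn : 0 < n) (hconv : ConvexPenalty pen)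
    (hpen : ∃ g, pen g ≠ ⊤) (h : IsRegularizedLSE pen y g) (h' : IsRegularizedLSE pen y' g') :
    ‖g - g'‖ ≤ ‖y - y'‖ := by
  obtain ⟨a, ha⟩ := WithTop.ne_top_iff_exists.1 (h.ne_top hpen)
  obtain ⟨b, hb⟩ := WithTop.ne_top_iff_exists.1 (h'.ne_top hpen)
  have h1 := h.inner_le hconv ha.symm hb.symm
  have h2 := h'.inner_le hconv hb.symm ha.symm
  have hsum : 2 / n * (⟪y - g, g' - g⟫ + ⟪y' - g', g - g'⟫) ≤ 0 := by rw [mul_add]; linarith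
  have hn' : (0 : ℝ) < n := by exact_mod_cast hn
  have hs : ⟪y - g, g' - g⟫ + ⟪y' - g', g - g'⟫ ≤ 0 := by
    by_contra hlt
    exact absurd hsum (not_le.2 (mul_pos (by positivity) (not_le.1 hlt)))
  have e : ⟪y - g, g' - g⟫ + ⟪y' - g', g - g'⟫ = ‖g - g'‖ ^ 2 - ⟪y - y', g - g'⟫ := by
    rw [← neg_sub g g', inner_neg_right, ← real_inner_self_eq_norm_sq, neg_add_eq_sub,
      ← inner_sub_left, ← inner_sub_left]
    congr 1
    module
  have hcs := real_inner_le_norm (y - y') (g - g')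
  by_contra hlt
  nlinarith [norm_nonneg (y - y'), norm_nonneg (g - g')]

end

/-- Constrained least squares is penalized by the indicator of the constraint set, which takes the
value `0` on the set and `⊤` off it. -/
lemma IsConstrainedLSE.isRegularizedLSE {n : ℕ} {G : Set (EuclideanSpace ℝ (Fin n))}
    {y g : EuclideanSpace ℝ (Fin n)} [DecidablePred (· ∈ G)] (h : IsConstrainedLSE G y g) :
    IsRegularizedLSE (fun x => if x ∈ G then 0 else ⊤) y g := by
  intro x
  by_cases hx : x ∈ G
  · simp only [hx, h.1, if_true, add_zero]
    exact WithTop.coe_le_coe.2 (h.2 x hx)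
  · simp [hx]

lemma Convex.convexPenalty_indicator {n : ℕ} {G : Set (EuclideanSpace ℝ (Fin n))}
    [DecidablePred (· ∈ G)] (hG : Convex ℝ G) :
    ConvexPenalty (fun x : EuclideanSpace ℝ (Fin n) => if x ∈ G then (0 : WithTop ℝ) else ⊤) := by
  have : {p : EuclideanSpace ℝ (Fin n) × ℝ |
      (if p.1 ∈ G then (0 : WithTop ℝ) else ⊤) ≤ (p.2 : WithTop ℝ)} = G ×ˢ Set.Ici 0 := by
    ext p
    by_cases hp : p.1 ∈ G <;> simp [hp]
  rw [ConvexPenalty, this]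
  exact hG.prod (convex_Ici 0)

/-! ### Concentration of the error -/

lemma IsGaussianNoise.hasLaw_inv_smul {Ω : Type*} [MeasurableSpace Ω] {P : Measure Ω}
    [IsProbabilityMeasure P] {n : ℕ} {σ : ℝ} (hσ : 0 < σ) {ε : Ω → EuclideanSpace ℝ (Fin n)}
    (hε : IsGaussianNoise P σ ε) :
    HasLaw (fun ω => σ⁻¹ • ε ω) (stdGaussian (EuclideanSpace ℝ (Fin n))) P := by
  have hZ (i : Fin n) : HasLaw (fun ω => σ⁻¹ * ε ω i) (gaussianReal 0 1) P := by
    have := gaussianReal_const_mul (hε.law i) σ⁻¹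
    convert this using 2
    · simp
    · refine NNReal.coe_injective ?_
      change 1 = σ⁻¹ ^ 2 * σ ^ 2
      field_simp
  have hm (i : Fin n) : AEMeasurable (fun ω => σ⁻¹ * ε ω i) P := (hZ i).aemeasurable
  have hind : iIndepFun (fun i ω => σ⁻¹ * ε ω i) P :=
    hε.indep.comp (fun _ x => σ⁻¹ * x) fun _ => measurable_const_mul _
  have hpi := (iIndepFun_iff_map_fun_eq_pi_map hm).1 hind
  simp only [fun i => (hZ i).map_eq] at hpi
  have hmp : AEMeasurable (fun ω i => σ⁻¹ * ε ω i) P := aemeasurable_pi_lambda _ hm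
  have heq : (fun ω => σ⁻¹ • ε ω) = WithLp.toLp 2 ∘ fun ω i => σ⁻¹ * ε ω i := by
    ext ω i
    simp
  refine ⟨?_, ?_⟩
  · rw [heq]
    exact (WithLp.measurable_toLp 2 _).comp_aemeasurable hmp
  · rw [heq, ← AEMeasurable.map_map_of_aemeasurable
      (WithLp.measurable_toLp 2 _).aemeasurable hmp, hpi, map_pi_eq_stdGaussian]

lemma errorConcentrates_of_isRegularizedLSE {Ω : Type*} [MeasurableSpace Ω] {P : Measure Ω}
    [IsProbabilityMeasure P] {n : ℕ} (hn : 0 < n) {σ : ℝ} (hσ : 0 < σ)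
    {g₀ : EuclideanSpace ℝ (Fin n)} {ε : Ω → EuclideanSpace ℝ (Fin n)}
    (hε : IsGaussianNoise P σ ε) {pen : EuclideanSpace ℝ (Fin n) → WithTop ℝ}
    (hconv : ConvexPenalty pen) (hpen : ∃ g, pen g ≠ ⊤) {ghat : Ω → EuclideanSpace ℝ (Fin n)}
    (hghat : ∀ᵐ ω ∂P, IsRegularizedLSE pen (g₀ + ε ω) (ghat ω)) :
    ErrorConcentrates P σ g₀ ghat := by
  have hn' : (0 : ℝ) < n := by exact_mod_cast hn
  have hsn : 0 < Real.sqrt n := Real.sqrt_pos.2 hn'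
  -- data without a minimizer receive a junk value, so the Lipschitz bound is first proved on the
  -- set of data that have one, and the function is then extended
  let S : Set (EuclideanSpace ℝ (Fin n)) := {z | ∃ g, IsRegularizedLSE pen (g₀ + σ • z) g}
  choose! ghat' hghat' using fun z (hz : z ∈ S) => hz
  have hlip : LipschitzOnWith 1 (fun z => σ⁻¹ * ‖ghat' z - g₀‖) S := by
    refine LipschitzOnWith.of_dist_le_mul fun z hz z' hz' => ?_
    have h1 := (hghat' z hz).norm_sub_le hn hconv hpen (hghat' z' hz')
    rw [add_sub_add_left_eq_sub, ← smul_sub, norm_smul, Real.norm_of_nonneg hσ.le] at h1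
    have h2 := abs_norm_sub_norm_le (ghat' z - g₀) (ghat' z' - g₀)
    rw [sub_sub_sub_cancel_right] at h2
    rw [Real.dist_eq, ← mul_sub, abs_mul, abs_of_pos (inv_pos.2 hσ), NNReal.coe_one, one_mul,
      dist_eq_norm, inv_mul_le_iff₀ hσ]
    exact h2.trans h1
  obtain ⟨f, hf, hfS⟩ := hlip.extend_real
  have hlaw := hε.hasLaw_inv_smul hσ
  have hae : (fun ω => normN (ghat ω - g₀)) =ᵐ[P]
      fun ω => σ / Real.sqrt n * f (σ⁻¹ • ε ω) := by
    filter_upwards [hghat] with ω hω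
    have hω' : IsRegularizedLSE pen (g₀ + σ • σ⁻¹ • ε ω) (ghat ω) := by
      rwa [smul_inv_smul₀ hσ.ne']
    have hmem : σ⁻¹ • ε ω ∈ S := ⟨_, hω'⟩
    have huniq := (hghat' _ hmem).norm_sub_le hn hconv hpen hω'
    rw [sub_self, norm_zero, norm_le_zero_iff, sub_eq_zero] at huniq
    rw [← hfS hmem, normN_eq]
    simp only [huniq]
    field_simp
  have hfi := hf.integrable_stdGaussian
  have hfc := hf.continuous.measurable
  have hi : Integrable (fun ω => f (σ⁻¹ • ε ω)) P := by
    have := hfi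
    rw [← hlaw.map_eq] at this
    exact this.comp_aemeasurable hlaw.aemeasurable
  have hmean : ∫ ω, f (σ⁻¹ • ε ω) ∂P = ∫ z, f z ∂(stdGaussian (EuclideanSpace ℝ (Fin n))) := by
    rw [← hlaw.map_eq, integral_map hlaw.aemeasurable hf.continuous.aestronglyMeasurable]
  refine ⟨(hi.const_mul _).congr hae.symm, fun t ht => ?_⟩
  rw [integral_congr_ae hae, integral_const_mul, hmean]
  set m := ∫ z, f z ∂(stdGaussian (EuclideanSpace ℝ (Fin n)))
  have hr : 0 < Real.sqrt (2 * t) := Real.sqrt_pos.2 (by linarith)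
  have hset : {ω | σ * Real.sqrt (2 * t / n) ≤ |normN (ghat ω - g₀) - σ / Real.sqrt n * m|} =ᵐ[P]
      (fun ω => σ⁻¹ • ε ω) ⁻¹' {z | Real.sqrt (2 * t) ≤ |f z - m|} := by
    filter_upwards [hae] with ω hω
    refine propext ?_
    change σ * Real.sqrt (2 * t / n) ≤ |normN (ghat ω - g₀) - σ / Real.sqrt n * m| ↔
      Real.sqrt (2 * t) ≤ |f (σ⁻¹ • ε ω) - m|
    rw [hω, ← mul_sub, abs_mul, abs_of_pos (div_pos hσ hsn), Real.sqrt_div' _ hn'.le,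
      mul_div_assoc', mul_div_right_comm]
    exact mul_le_mul_iff_right₀ (div_pos hσ hsn)
  have hms : MeasurableSet {z | Real.sqrt (2 * t) ≤ |f z - m|} :=
    measurableSet_le measurable_const (hfc.sub_const m).abs
  have h := hf.measureReal_le_exp_stdGaussian hr
  rw [Real.sq_sqrt (by linarith), mul_div_cancel_left₀ t two_ne_zero] at h
  rw [measureReal_congr hset, ← map_measureReal_apply_of_aemeasurable hlaw.aemeasurable hms,
    hlaw.map_eq]
  exact h

theorem mainTheorem2 {Ω : Type*} [MeasurableSpace Ω] (P : Measure Ω) [IsProbabilityMeasure P]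
    (n : ℕ) (hn : 0 < n) (σ : ℝ) (hσ : 0 < σ)
    (g₀ : EuclideanSpace ℝ (Fin n)) (ε : Ω → EuclideanSpace ℝ (Fin n))
    (hε : IsGaussianNoise P σ ε) :
    (∀ pen : EuclideanSpace ℝ (Fin n) → WithTop ℝ, ConvexPenalty pen → (∃ g, pen g ≠ ⊤) →
      ∀ ghat : Ω → EuclideanSpace ℝ (Fin n),
        (∀ᵐ ω ∂P, IsRegularizedLSE pen (g₀ + ε ω) (ghat ω)) →
          ErrorConcentrates P σ g₀ ghat) ∧
    (∀ G : Set (EuclideanSpace ℝ (Fin n)), IsClosed G → Convex ℝ G →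
      ∀ ghat : Ω → EuclideanSpace ℝ (Fin n),
        (∀ᵐ ω ∂P, IsConstrainedLSE G (g₀ + ε ω) (ghat ω)) →
          ErrorConcentrates P σ g₀ ghat) := by
  refine ⟨fun pen hconv hpen ghat hghat =>
    errorConcentrates_of_isRegularizedLSE hn hσ hε hconv hpen hghat, fun G _ hG ghat hghat => ?_⟩
  classical
  obtain ⟨ω, hω⟩ := hghat.exists
  exact errorConcentrates_of_isRegularizedLSE hn hσ hε hG.convexPenalty_indicator
    ⟨ghat ω, by simp [hω.1]⟩ (hghat.mono fun _ h => h.isRegularizedLSE)
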